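/- **Definitions.** A covariance function on a set $X$ is a symmetric kernel $K:X\times X\to\mathbb R$ with $\sum_{i,j}a_ia_jK(x_i,x_j)\ge 0$ for all finite families of points $x_i\in X$ and reals $a_i$. A function $C$ on $\mathbb R^m$ is a stationary covariance function if $(x,y)\mapsto C(x-y)$ is a covariance function. A function $\gamma:\mathbb R^m\to\mathbb R$ is an intrinsically stationary variogram if $\sum_{i,j}a_ia_j\gamma(x_i-x_j)\le 0$ for all finite families of points $x_i$ and reals $a_i$ with $\sum_i a_i=0$. A function $f$ is completely monotone on $(0,\infty)$ if it is smooth there and $(-1)^kf^{(k)}\ge 0$ for all $k\ge 0$; it is a Bernstein function if it is nonnegative and differentiable on $(0,\infty)$ and $f'$ is completely monotone there. A function of $(\mathbf x_1,\dots,\mathbf x_n)$ is fully symmetric if it does not change when any of the blocks $\mathbf x_i$ are replaced by $-\mathbf x_i$. **Setting.** Let $D$ be $(0,\infty)$ or $[0,\infty)$, let $\varphi:D\to\mathbb R$ be continuous on $D$ and completely monotone on $(0,\infty)$, and let $\varphi^{-1}:E\to D$, $E\subset\mathbb R$, satisfy $\varphi(\varphi^{-1}(u))=u$ for all $u\in E$.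 Let $\theta_1,\dots,\theta_n\ge 0$, not all zero unless $0\in D$. **(a) General case.** Let $d_1,\dots,d_n\ge 1$, $d=d_1+\dots+d_n$, and let $C_i:\mathbb R^{d_i}\to\mathbb R$ be continuous stationary covariance functions with values in $E$. If each $\varphi^{-1}\circ C_i$ is an intrinsically stationary variogram on $\mathbb R^{d_i}$, then $$(\mathbf x_1,\dots,\mathbf x_n)\mapsto \varphi\Big(\sum_{i=1}^n\theta_i\,\varphi^{-1}(C_i(\mathbf x_i))\Big)$$ is a continuous stationary covariance function on $\mathbb R^d=\mathbb R^{d_1}\times\dots\times\mathbb R^{d_n}$. **(b) Component-wise isotropy.** Let $d_1,\dots,d_n\ge 1$, $d=d_1+\dots+d_n$, and let the functions $\mathbf x\mapsto C_i(\|\mathbf x\|)$ be continuous (isotropic) stationary covariance functions on $\mathbb R^{d_i}$ with values in $E$, where $\|\cdot\|$ is the Euclidean norm. If each $r\mapsto\varphi^{-1}(C_i(r))$ is a Bernstein function on $(0,\infty)$, then $$(\mathbf x_1,\dots,\mathbf x_n)\mapsto \varphi\Big(\sum_{i=1}^n\theta_i\,\varphi^{-1}(C_i(\|\mathbf x_i\|))\Big)$$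 is a continuous, fully symmetric stationary covariance function on $\mathbb R^d$. **(c) Univariate covariances.** Let the functions $x\mapsto C_i(|x|)$ be continuous stationary covariance functions on $\mathbb R$ with values in $E$. If each $r\mapsto\varphi^{-1}(C_i(r))$ is continuous, nondecreasing and concave on $(0,\infty)$, then $$(x_1,\dots,x_n)\mapsto \varphi\Big(\sum_{i=1}^n\theta_i\,\varphi^{-1}(C_i(|x_i|))\Big)$$ is a continuous, fully symmetric stationary covariance function on $\mathbb R^n$. -/

import Mathlib

open Set
open scoped ContDiff

/-- `K` is a covariance function on `X`: a symmetric, positive definite real kernel. -/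
def IsCovariance {X : Type*} (K : X → X → ℝ) : Prop :=
  (∀ x y, K x y = K y x) ∧
    ∀ (m : ℕ) (a : Fin m → ℝ) (x : Fin m → X),
      0 ≤ ∑ i, ∑ j, a i * a j * K (x i) (x j)

/-- `C` is a stationary covariance function: `(x, y) ↦ C (x - y)` is a covariance function. -/
def IsStationaryCovariance {G : Type*} [AddCommGroup G] (C : G → ℝ) : Prop :=
  IsCovariance fun x y => C (x - y)

/-- `γ` is an intrinsically stationary variogram, that is, conditionally negative definite. -/
def IsVariogram {G : Type*} [AddCommGroup G] (γ : G → ℝ) : Prop :=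
  ∀ (m : ℕ) (a : Fin m → ℝ) (x : Fin m → G), ∑ i, a i = 0 →
    ∑ i, ∑ j, a i * a j * γ (x i - x j) ≤ 0

/-- Complete monotonicity on the positive real line `(0, ∞)`. The case `k = 0` gives `0 ≤ f`. -/
def IsCompletelyMonotone (f : ℝ → ℝ) : Prop :=
  ContDiffOn ℝ ∞ f (Ioi 0) ∧ ∀ (k : ℕ) (t : ℝ), 0 < t → 0 ≤ (-1 : ℝ) ^ k * iteratedDeriv k f t

/-- Bernstein functions on the positive real line `(0, ∞)`: nonnegative, differentiable, with
completely monotone first derivative. -/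
def IsBernstein (f : ℝ → ℝ) : Prop :=
  (∀ t, 0 < t → 0 ≤ f t) ∧ DifferentiableOn ℝ f (Ioi 0) ∧ IsCompletelyMonotone (deriv f)

/-- `φ` is a completely monotone generating function with domain `D`, the open or the closed
positive half-line (continuous at the endpoint in the latter case), and `φinv`, with domain `E`,
is an inverse of it: `φinv` maps `E` into `D` and `φ (φinv u) = u` on `E`.
The values of `φ` off `D` and of `φinv` off `E` are irrelevant. -/
structure IsCMGenerator (φ φinv : ℝ → ℝ) (D E : Set ℝ) : Prop where
  domain_eq : D = Ioi 0 ∨ D = Ici 0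
  continuousOn : ContinuousOn φ D
  completelyMonotone : IsCompletelyMonotone φ
  mapsTo : MapsTo φinv E D
  apply_inv : ∀ u ∈ E, φ (φinv u) = u

/-- The quasi-arithmetic composition `(x₁, …, xₙ) ↦ φ (∑ᵢ θᵢ φ⁻¹ (fᵢ (xᵢ)))`. -/
noncomputable def quasiArith (φ φinv : ℝ → ℝ) {n : ℕ} (θ : Fin n → ℝ) {V : Fin n → Type*}
    (f : ∀ i, V i → ℝ) (x : ∀ i, V i) : ℝ :=
  φ (∑ i, θ i * φinv (f i (x i)))

/-- Full (reflection) symmetry: the value of `F` does not change when any set of the blocks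
`x₁, …, xₙ` is replaced by their negatives. -/
def IsFullySymmetric {n : ℕ} {V : Fin n → Type*} [∀ i, AddCommGroup (V i)]
    (F : (∀ i, V i) → ℝ) : Prop :=
  ∀ (S : Finset (Fin n)) (x : ∀ i, V i), F (fun i => if i ∈ S then -x i else x i) = F x

open Filter Topology MeasureTheory

/-! Everything rests on one principle: a completely monotone function `f` of a positive,
conditionally negative definite kernel `γ` is positive definite. The Taylor series of `f` at `1/s`,
evaluated at `(1 - exp(-sγ))/s`, is a power series in `exp(-sγ)` with nonnegative coefficients.
Schoenberg's theorem makes `exp(-sγ)` positive definite, Schur's its powers, and `s → 0` recovers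
`f(γ)` (`IsCompletelyMonotone.isCovariance_comp`); no representing measure is needed.

Weighted sums of variograms are conditionally negative definite on the product space, whence (a).
For (b), the same series without its constant term shows that Bernstein functions preserve
conditional negative definiteness (`AlternatingDerivs.isCondNeg_neg_comp`), and the Euclidean
distance is such a kernel. For (c), a concave profile agrees, on finitely many distances, with a
constant plus a nonnegative combination of functions `min r a` (`exists_isVariogram_interpolation`).

Continuity holds because a generator is either constant, a trivial case, or strictly decreasing,
which makes `φinv ∘ C` continuous. -/

/-- A kernel is conditionally negative definite if its quadratic form is nonpositive on all
coefficient vectors of zero sum. -/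
def IsCondNeg {X : Type*} (γ : X → X → ℝ) : Prop :=
  ∀ (m : ℕ) (a : Fin m → ℝ) (x : Fin m → X), ∑ i, a i = 0 →
    ∑ i, ∑ j, a i * a j * γ (x i) (x j) ≤ 0

/-! ### Positive definite and conditionally negative definite kernels. -/

section Kernels

variable {X Y : Type*} {K L γ δ : X → X → ℝ}

theorem quadForm_add {m : ℕ} (a : Fin m → ℝ) (A B : Fin m → Fin m → ℝ) :
    ∑ i, ∑ j, a i * a j * (A i j + B i j) =
      ∑ i, ∑ j, a i * a j * A i j + ∑ i, ∑ j, a i * a j * B i j := by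
  simp only [mul_add, Finset.sum_add_distrib]

theorem quadForm_smul {m : ℕ} (a : Fin m → ℝ) (c : ℝ) (A : Fin m → Fin m → ℝ) :
    ∑ i, ∑ j, a i * a j * (c * A i j) = c * ∑ i, ∑ j, a i * a j * A i j := by
  simp only [Finset.mul_sum]
  exact Finset.sum_congr rfl fun i _ => Finset.sum_congr rfl fun j _ => by ring

theorem quadForm_rank_one {m : ℕ} (a u v : Fin m → ℝ) :
    ∑ i, ∑ j, a i * a j * (u i * v j) = (∑ i, a i * u i) * ∑ j, a j * v j := by
  rw [Finset.sum_mul_sum]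
  exact Finset.sum_congr rfl fun i _ => Finset.sum_congr rfl fun j _ => by ring

theorem quadForm_left {m : ℕ} (a u : Fin m → ℝ) (ha : ∑ i, a i = 0) :
    ∑ i, ∑ j, a i * a j * u i = 0 := by
  have := quadForm_rank_one a u fun _ => 1
  simpa [ha] using this

theorem quadForm_right {m : ℕ} (a u : Fin m → ℝ) (ha : ∑ i, a i = 0) :
    ∑ i, ∑ j, a i * a j * u j = 0 := by
  have := quadForm_rank_one a (fun _ => 1) u
  simpa [ha] using this

theorem tendsto_quadForm {ι : Type*} {l : Filter ι} {m : ℕ} (a : Fin m → ℝ)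
    {A : ι → Fin m → Fin m → ℝ} {B : Fin m → Fin m → ℝ}
    (h : ∀ i j, Tendsto (fun s => A s i j) l (𝓝 (B i j))) :
    Tendsto (fun s => ∑ i, ∑ j, a i * a j * A s i j) l (𝓝 (∑ i, ∑ j, a i * a j * B i j)) :=
  tendsto_finsetSum _ fun i _ => tendsto_finsetSum _ fun j _ => (h i j).const_mul _

theorem IsCovariance.const {c : ℝ} (hc : 0 ≤ c) : IsCovariance fun _ _ : X => c := by
  refine ⟨fun _ _ => rfl, fun m a x => ?_⟩
  have := quadForm_rank_one a (fun _ => c) fun _ => 1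
  simp only [mul_one] at this
  rw [this, ← Finset.sum_mul, mul_right_comm]
  exact mul_nonneg (mul_self_nonneg _) hc

theorem IsCovariance.add (hK : IsCovariance K) (hL : IsCovariance L) :
    IsCovariance fun x y => K x y + L x y := by
  refine ⟨fun x y => by simp only [hK.1 x y, hL.1 x y], fun m a x => ?_⟩
  rw [quadForm_add a (fun i j => K (x i) (x j)) fun i j => L (x i) (x j)]
  exact add_nonneg (hK.2 m a x) (hL.2 m a x)

theorem IsCovariance.smul {c : ℝ} (hc : 0 ≤ c) (hK : IsCovariance K) :
    IsCovariance fun x y => c * K x y := by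
  refine ⟨fun x y => by simp only [hK.1 x y], fun m a x => ?_⟩
  rw [quadForm_smul a c fun i j => K (x i) (x j)]
  exact mul_nonneg hc (hK.2 m a x)

theorem IsCovariance.posSemidef (hK : IsCovariance K) {m : ℕ} (x : Fin m → X) :
    (Matrix.of fun i j => K (x i) (x j)).PosSemidef := by
  refine Matrix.PosSemidef.of_dotProduct_mulVec_nonneg ?_ fun a => ?_
  · ext i j
    simp [hK.1 (x j)]
  · have := hK.2 m a x
    simpa [dotProduct, Matrix.mulVec, Finset.mul_sum, mul_assoc, mul_comm, mul_left_comm] using this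

/-- The Schur product theorem for kernels. -/
theorem IsCovariance.mul (hK : IsCovariance K) (hL : IsCovariance L) :
    IsCovariance fun x y => K x y * L x y := by
  refine ⟨fun x y => by simp only [hK.1 x y, hL.1 x y], fun m a x => ?_⟩
  have := ((hK.posSemidef x).hadamard (hL.posSemidef x)).dotProduct_mulVec_nonneg a
  simpa [dotProduct, Matrix.mulVec, Finset.mul_sum, mul_assoc, mul_comm, mul_left_comm] using this

theorem IsCovariance.pow (hK : IsCovariance K) (k : ℕ) : IsCovariance fun x y => K x y ^ k := by
  induction k with
  | zero => simpa using IsCovariance.const (X := X) zero_le_one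
  | succ k ih => simpa only [pow_succ] using ih.mul hK

theorem IsCovariance.of_tendsto {ι : Type*} {l : Filter ι} [l.NeBot] {A : ι → X → X → ℝ}
    (hA : ∀ᶠ s in l, IsCovariance (A s))
    (h : ∀ x y, Tendsto (fun s => A s x y) l (𝓝 (K x y))) : IsCovariance K := by
  refine ⟨fun x y => ?_, fun m a x => ?_⟩
  · refine tendsto_nhds_unique ((h x y).congr' ?_) (h y x)
    filter_upwards [hA] with s hs using hs.1 x y
  · refine ge_of_tendsto (tendsto_quadForm a fun i j => h (x i) (x j)) ?_
    filter_upwards [hA] with s hs using hs.2 m a x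

theorem IsCovariance.finsetSum {ι : Type*} (s : Finset ι) {A : ι → X → X → ℝ}
    (hA : ∀ k, IsCovariance (A k)) : IsCovariance fun x y => ∑ k ∈ s, A k x y := by
  classical
  induction s using Finset.induction_on with
  | empty => simpa using IsCovariance.const (X := X) le_rfl
  | insert k s hk ih => simpa only [Finset.sum_insert hk] using (hA k).add ih

theorem IsCovariance.of_hasSum {ι : Type*} {A : ι → X → X → ℝ} (hA : ∀ k, IsCovariance (A k))
    (h : ∀ x y, HasSum (fun k => A k x y) (K x y)) : IsCovariance K :=
  IsCovariance.of_tendsto (l := atTop) (Eventually.of_forall fun s => IsCovariance.finsetSum s hA) h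

theorem IsCovariance.exp (hK : IsCovariance K) : IsCovariance fun x y => Real.exp (K x y) :=
  IsCovariance.of_hasSum (A := fun k x y => ((k.factorial : ℝ)⁻¹) * K x y ^ k)
    (fun k => (hK.pow k).smul (by positivity)) fun x y => by
      simpa [Real.exp_eq_exp_ℝ, div_eq_inv_mul] using NormedSpace.expSeries_div_hasSum_exp (K x y)

theorem IsCovariance.isCondNeg_neg (hK : IsCovariance K) : IsCondNeg fun x y => -K x y := by
  intro m a x _
  simpa [Finset.sum_neg_distrib] using hK.2 m a x

theorem IsCondNeg.of_const (c : ℝ) : IsCondNeg fun _ _ : X => c :=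
  fun _ a _ ha => (quadForm_left a (fun _ => c) ha).le

theorem IsCondNeg.add (hγ : IsCondNeg γ) (hδ : IsCondNeg δ) :
    IsCondNeg fun x y => γ x y + δ x y := by
  intro m a x ha
  rw [quadForm_add a (fun i j => γ (x i) (x j)) fun i j => δ (x i) (x j)]
  exact add_nonpos (hγ m a x ha) (hδ m a x ha)

theorem IsCondNeg.smul {c : ℝ} (hc : 0 ≤ c) (hγ : IsCondNeg γ) :
    IsCondNeg fun x y => c * γ x y := by
  intro m a x ha
  rw [quadForm_smul a c fun i j => γ (x i) (x j)]
  exact mul_nonpos_of_nonneg_of_nonpos hc (hγ m a x ha)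

theorem IsCondNeg.finsetSum {ι : Type*} (s : Finset ι) {A : ι → X → X → ℝ}
    (hA : ∀ k, IsCondNeg (A k)) : IsCondNeg fun x y => ∑ k ∈ s, A k x y := by
  classical
  induction s using Finset.induction_on with
  | empty => simpa using IsCondNeg.of_const (X := X) 0
  | insert k s hk ih => simpa only [Finset.sum_insert hk] using (hA k).add ih

theorem IsCondNeg.comp (hγ : IsCondNeg γ) (f : Y → X) : IsCondNeg fun x y => γ (f x) (f y) :=
  fun m a x => hγ m a fun i => f (x i)

theorem IsCondNeg.of_tendsto {ι : Type*} {l : Filter ι} [l.NeBot] {A : ι → X → X → ℝ}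
    (hA : ∀ᶠ s in l, IsCondNeg (A s))
    (h : ∀ x y, Tendsto (fun s => A s x y) l (𝓝 (γ x y))) : IsCondNeg γ := by
  intro m a x ha
  refine le_of_tendsto (tendsto_quadForm a fun i j => h (x i) (x j)) ?_
  filter_upwards [hA] with s hs using hs m a x ha

/-- Adjoining the point `o` with weight `-∑ a i` turns any coefficient vector into one of zero sum.
-/
theorem IsCondNeg.isCovariance_add_sub (hγ : IsCondNeg γ) (hs : ∀ x y, γ x y = γ y x) (o : X) :
    IsCovariance fun x y => γ x o + γ o y - γ x y - γ o o := by
  refine ⟨fun x y => by simp only [hs x y, hs x o, hs o y]; ring, fun m a x => ?_⟩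
  have h := hγ (m + 1) (Fin.cons (-∑ i, a i) a) (Fin.cons o x) (by simp [Fin.sum_univ_succ])
  simp only [Fin.sum_univ_succ, Fin.cons_zero, Fin.cons_succ, Finset.sum_add_distrib] at h
  have h1 : ∑ i, ∑ j, a i * a j * γ (x i) o = (∑ i, a i * γ (x i) o) * ∑ j, a j := by
    simpa using quadForm_rank_one a (fun i => γ (x i) o) fun _ => 1
  have h2 : ∑ i, ∑ j, a i * a j * γ o (x j) = (∑ i, a i) * ∑ j, a j * γ o (x j) := by
    simpa using quadForm_rank_one a (fun _ => 1) fun j => γ o (x j)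
  have h3 : ∑ i, ∑ j, a i * a j * γ o o = (∑ i, a i) * (∑ j, a j) * γ o o := by
    simpa [← Finset.sum_mul, mul_assoc] using quadForm_rank_one a (fun _ => 1) fun _ => γ o o
  have h4 (c : ℝ) : ∑ j, c * a j * γ o (x j) = c * ∑ j, a j * γ o (x j) := by
    simp only [mul_assoc, Finset.mul_sum]
  have h5 (c : ℝ) : ∑ j, a j * c * γ (x j) o = c * ∑ j, a j * γ (x j) o := by
    simp only [mul_assoc, mul_left_comm (a _) c, Finset.mul_sum]
  simp only [mul_sub, mul_add, Finset.sum_sub_distrib, Finset.sum_add_distrib, h1, h2, h3]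
  rw [h4, h5] at h
  linarith

/-- Schoenberg's theorem. -/
theorem IsCondNeg.isCovariance_exp_neg (hγ : IsCondNeg γ) (hs : ∀ x y, γ x y = γ y x) :
    IsCovariance fun x y => Real.exp (-γ x y) := by
  rcases isEmpty_or_nonempty X with hX | ⟨⟨o⟩⟩
  · exact ⟨fun x => (hX.false x).elim, fun m a x => by
      rcases m with - | m
      · simp
      · exact (hX.false (x 0)).elim⟩
  -- `exp(-γ x y)` is the exponential of the kernel based at `o`, times `exp(γ o o)`, times the
  -- rank-one kernel `hr`.
  have h := ((hγ.isCovariance_add_sub hs o).exp).smul (Real.exp_pos (γ o o)).le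
  have hr : IsCovariance fun x y : X => Real.exp (-γ x o) * Real.exp (-γ y o) := by
    refine ⟨fun x y => mul_comm _ _, fun m a x => ?_⟩
    rw [quadForm_rank_one a (fun i => Real.exp (-γ (x i) o)) fun i => Real.exp (-γ (x i) o)]
    exact mul_self_nonneg _
  have := h.mul hr
  refine (congrArg IsCovariance (funext₂ fun x y => ?_)).mpr this
  rw [← Real.exp_add, ← Real.exp_add, ← Real.exp_add, hs o y]
  congr 1
  ring

/-- The quadratic form is the integral of the square of `∑ a i • 1_{s (x i)}`. -/
theorem isCovariance_measure_inter {α : Type*} [MeasurableSpace α] (μ : Measure α) (s : X → Set α)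
    (hs : ∀ x, MeasurableSet (s x)) (hμ : ∀ x, μ (s x) ≠ ⊤) :
    IsCovariance fun x y => μ.real (s x ∩ s y) := by
  refine ⟨fun x y => by simp only [inter_comm], fun m a x => ?_⟩
  have hi : ∀ i j, Integrable ((s (x i) ∩ s (x j)).indicator fun _ => (1 : ℝ)) μ := fun i j =>
    (integrable_indicator_iff ((hs _).inter (hs _))).2
      (integrableOn_const (measure_ne_top_of_subset inter_subset_left (hμ _)))
  have : ∑ i, ∑ j, a i * a j * μ.real (s (x i) ∩ s (x j)) =
      ∫ t, (∑ i, a i * (s (x i)).indicator (fun _ => (1 : ℝ)) t) ^ 2 ∂μ := by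
    have e : ∀ t, (∑ i, a i * (s (x i)).indicator (fun _ => (1 : ℝ)) t) ^ 2 =
        ∑ i, ∑ j, a i * a j * (s (x i) ∩ s (x j)).indicator (fun _ => (1 : ℝ)) t := by
      intro t
      rw [sq, Finset.sum_mul_sum]
      refine Finset.sum_congr rfl fun i _ => Finset.sum_congr rfl fun j _ => ?_
      by_cases h1 : t ∈ s (x i) <;> by_cases h2 : t ∈ s (x j) <;> simp [h1, h2]
    simp only [e]
    rw [integral_finsetSum _ fun i _ => integrable_finsetSum _ fun j _ => (hi i j).const_mul _]
    refine Finset.sum_congr rfl fun i _ => ?_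
    rw [integral_finsetSum _ fun j _ => (hi i j).const_mul _]
    refine Finset.sum_congr rfl fun j _ => ?_
    rw [integral_const_mul, integral_indicator_const _ ((hs _).inter (hs _))]
    simp
  rw [this]
  exact integral_nonneg fun t => sq_nonneg _

/-- The intervals `[x, x + r]` and `[y, y + r]` overlap in length `r - min |x - y| r`. -/
theorem isCondNeg_min_abs_sub {r : ℝ} (hr : 0 ≤ r) :
    IsCondNeg fun x y : ℝ => min |x - y| r := by
  have h := (isCovariance_measure_inter volume (fun x : ℝ => Icc x (x + r))
    (fun _ => measurableSet_Icc) fun x => by simp).isCondNeg_neg.add (IsCondNeg.of_const r)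
  refine (congrArg IsCondNeg (funext₂ fun x y => ?_)).mpr h
  rw [Icc_inter_Icc, Measure.real, Real.volume_Icc, ENNReal.toReal_ofReal']
  grind

/-- For zero-sum weights only the cross term survives, and it contributes `-2 ‖∑ a i • x i‖ ^ 2`. -/
theorem isCondNeg_norm_sub_sq {V : Type*} [NormedAddCommGroup V] [InnerProductSpace ℝ V] :
    IsCondNeg fun x y : V => ‖x - y‖ ^ 2 := by
  intro m a x ha
  have e : ∑ i, ∑ j, a i * a j * inner ℝ (x i) (x j) = ‖∑ i, a i • x i‖ ^ 2 := by
    rw [← real_inner_self_eq_norm_sq, sum_inner]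
    refine Finset.sum_congr rfl fun i _ => ?_
    rw [inner_sum]
    refine Finset.sum_congr rfl fun j _ => ?_
    rw [real_inner_smul_left, real_inner_smul_right, mul_assoc]
  have e2 := quadForm_smul a 2 fun i j => inner ℝ (x i) (x j)
  simp only [norm_sub_sq_real, mul_sub, mul_add, Finset.sum_sub_distrib, Finset.sum_add_distrib,
    quadForm_left a (fun i => ‖x i‖ ^ 2) ha, quadForm_right a (fun i => ‖x i‖ ^ 2) ha, e2, e]
  nlinarith [sq_nonneg ‖∑ i, a i • x i‖]

end Kernels

/-! ### Taylor series of functions with alternating derivatives. -/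

/-- Smooth functions on `(0, ∞)` whose derivatives of positive order alternate in sign, the first
being nonpositive: completely monotone functions and the negatives of Bernstein functions. -/
def AlternatingDerivs (f : ℝ → ℝ) : Prop :=
  ContDiffOn ℝ ∞ f (Ioi 0) ∧
    ∀ (k : ℕ) (t : ℝ), 0 < t → 0 ≤ (-1 : ℝ) ^ (k + 1) * iteratedDeriv (k + 1) f t

theorem IsCompletelyMonotone.alternatingDerivs {f : ℝ → ℝ} (hf : IsCompletelyMonotone f) :
    AlternatingDerivs f :=
  ⟨hf.1, fun k => hf.2 (k + 1)⟩

theorem IsBernstein.alternatingDerivs_neg {f : ℝ → ℝ} (hf : IsBernstein f) :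
    AlternatingDerivs fun t => -f t := by
  refine ⟨((contDiffOn_infty_iff_deriv_of_isOpen isOpen_Ioi).2 ⟨hf.2.1, hf.2.2.1⟩).neg,
    fun k t ht => ?_⟩
  have := hf.2.2.2 k t ht
  rw [show (fun t => -f t) = -f from rfl, iteratedDeriv_neg, iteratedDeriv_succ', pow_succ]
  linarith

section Taylor

variable {f : ℝ → ℝ}

/-- The `k`-th term of the Taylor expansion of `f` at `a`, evaluated at `y`. -/
noncomputable def taylorTerm (f : ℝ → ℝ) (a y : ℝ) (k : ℕ) : ℝ :=
  (-1 : ℝ) ^ k * iteratedDeriv k f a / k.factorial * (a - y) ^ k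

theorem ContDiffOn.iteratedDerivWithin_Icc_eq (hf : ContDiffOn ℝ ∞ f (Ioi 0)) {a y t : ℝ}
    (hy : 0 < y) (hya : y < a) (ht : t ∈ Icc y a) (k : ℕ) :
    iteratedDerivWithin k f (Icc y a) t = iteratedDeriv k f t :=
  iteratedDerivWithin_eq_iteratedDeriv (uniqueDiffOn_Icc hya)
    ((hf.contDiffAt (Ioi_mem_nhds (hy.trans_le ht.1))).of_le (by exact_mod_cast le_top)) ht

theorem ContDiffOn.continuousOn_iteratedDeriv_Icc (hf : ContDiffOn ℝ ∞ f (Ioi 0)) {a y : ℝ}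
    (hy : 0 < y) (hya : y < a) (k : ℕ) : ContinuousOn (iteratedDeriv k f) (Icc y a) :=
  ((hf.mono fun _ ht => hy.trans_le ht.1).continuousOn_iteratedDerivWithin
    (m := k) (by exact_mod_cast le_top) (uniqueDiffOn_Icc hya)).congr fun _ ht =>
      (hf.iteratedDerivWithin_Icc_eq hy hya ht k).symm

theorem ContDiffOn.sub_sum_taylorTerm (hf : ContDiffOn ℝ ∞ f (Ioi 0)) {a y : ℝ}
    (hy : 0 < y) (hya : y < a) (n : ℕ) :
    f y - ∑ k ∈ Finset.range (n + 1), taylorTerm f a y k =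
      ∫ t in y..a, (t - y) ^ n / n.factorial * ((-1) ^ (n + 1) * iteratedDeriv (n + 1) f t) := by
  have hI : uIcc a y = Icc y a := uIcc_of_ge hya.le
  have h := taylor_integral_remainder (f := f) (x := y) (x₀ := a) (n := n) (by
    rw [hI]
    exact (hf.mono fun _ ht => hy.trans_le ht.1).of_le (by exact_mod_cast le_top))
  rw [hI, taylor_within_apply] at h
  have e1 : ∑ k ∈ Finset.range (n + 1), taylorTerm f a y k =
      ∑ k ∈ Finset.range (n + 1), (((k.factorial : ℝ)⁻¹ * (y - a) ^ k) •
        iteratedDerivWithin k f (Icc y a) a) := by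
    refine Finset.sum_congr rfl fun k _ => ?_
    rw [hf.iteratedDerivWithin_Icc_eq hy hya (right_mem_Icc.2 hya.le), taylorTerm, smul_eq_mul,
      ← neg_sub a y, neg_pow (a - y)]
    ring
  rw [e1, h, intervalIntegral.integral_symm, ← intervalIntegral.integral_neg]
  refine intervalIntegral.integral_congr fun t ht => ?_
  rw [uIcc_of_le hya.le] at ht
  simp only [hf.iteratedDerivWithin_Icc_eq hy hya ht, smul_eq_mul]
  rw [← neg_sub t y, neg_pow (t - y)]
  ring

theorem AlternatingDerivs.taylorTerm_nonneg (hf : AlternatingDerivs f) {a y : ℝ} (ha : 0 < a)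
    (hya : y ≤ a) {k : ℕ} (hk : k ≠ 0) : 0 ≤ taylorTerm f a y k := by
  obtain ⟨k, rfl⟩ := Nat.exists_eq_succ_of_ne_zero hk
  exact mul_nonneg (div_nonneg (hf.2 k a ha) (by positivity)) (pow_nonneg (by linarith) _)

theorem AlternatingDerivs.remainder_nonneg (hf : AlternatingDerivs f) {a y : ℝ} (hy : 0 < y)
    (hya : y < a) (n : ℕ) :
    0 ≤ f y - ∑ k ∈ Finset.range (n + 1), taylorTerm f a y k := by
  rw [hf.1.sub_sum_taylorTerm hy hya]
  refine intervalIntegral.integral_nonneg hya.le fun t ht =>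
    mul_nonneg ?_ (hf.2 n t (hy.trans_le ht.1))
  exact div_nonneg (pow_nonneg (sub_nonneg.2 ht.1) _) (by positivity)

/-- On `[y, a]`, `t - y ≤ (a - y)/(a - z) * (t - z)`, so the remainder at `y` is at most a geometric
factor times the remainder at `z`. The latter is at most `f z - f a`, since the terms of positive
order are nonnegative. -/
theorem AlternatingDerivs.remainder_le (hf : AlternatingDerivs f) {a y z : ℝ} (hz : 0 < z)
    (hzy : z < y) (hya : y < a) (n : ℕ) :
    f y - ∑ k ∈ Finset.range (n + 1), taylorTerm f a y k ≤
      ((a - y) / (a - z)) ^ n * (f z - f a) := by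
  have hy := hz.trans hzy
  have hza := hzy.trans hya
  have hcont : ∀ w, ContinuousOn (fun t => (t - w) ^ n / n.factorial *
      ((-1) ^ (n + 1) * iteratedDeriv (n + 1) f t)) (Icc z a) := fun w =>
    ContinuousOn.mul (by fun_prop)
      (continuousOn_const.mul (hf.1.continuousOn_iteratedDeriv_Icc hz hza _))
  have hint : ∀ w, IntervalIntegrable (fun t => (t - w) ^ n / n.factorial *
      ((-1) ^ (n + 1) * iteratedDeriv (n + 1) f t)) volume z a := fun w =>
    ContinuousOn.intervalIntegrable (by rw [uIcc_of_le hza.le]; exact hcont w)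
  have hsub : ∀ w, IntervalIntegrable (fun t => (t - w) ^ n / n.factorial *
      ((-1) ^ (n + 1) * iteratedDeriv (n + 1) f t)) volume y a := fun w =>
    (hint w).mono_set (by
      rw [uIcc_of_le hza.le, uIcc_of_le hya.le]; exact Icc_subset_Icc_left hzy.le)
  have h1 : ∫ t in y..a, (t - y) ^ n / n.factorial *
        ((-1) ^ (n + 1) * iteratedDeriv (n + 1) f t) ≤
      ∫ t in y..a, ((a - y) / (a - z)) ^ n * ((t - z) ^ n / n.factorial *
        ((-1) ^ (n + 1) * iteratedDeriv (n + 1) f t)) := by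
    refine intervalIntegral.integral_mono_on hya.le (hsub y) ((hsub z).const_mul _) fun t ht => ?_
    rw [← mul_assoc (((a - y) / (a - z)) ^ n), ← mul_div_assoc, ← mul_pow]
    refine mul_le_mul_of_nonneg_right ?_ (hf.2 n t (hy.trans_le ht.1))
    refine div_le_div_of_nonneg_right (pow_le_pow_left₀ (sub_nonneg.2 ht.1) ?_ n) (by positivity)
    rw [div_mul_eq_mul_div, le_div_iff₀ (by linarith)]
    nlinarith [mul_nonneg (sub_nonneg.2 hzy.le) (sub_nonneg.2 ht.2)]
  have h2 : ∫ t in y..a, (t - z) ^ n / n.factorial *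
        ((-1) ^ (n + 1) * iteratedDeriv (n + 1) f t) ≤
      ∫ t in z..a, (t - z) ^ n / n.factorial *
        ((-1) ^ (n + 1) * iteratedDeriv (n + 1) f t) := by
    refine intervalIntegral.integral_mono_interval hzy.le hya.le le_rfl ?_ (hint z)
    refine (ae_restrict_iff' measurableSet_Ioc).2 (Eventually.of_forall fun t ht => ?_)
    exact mul_nonneg (div_nonneg (pow_nonneg (sub_nonneg.2 ht.1.le) _) (by positivity))
      (hf.2 n t (hz.trans ht.1))
  have h3 : f a ≤ ∑ k ∈ Finset.range (n + 1), taylorTerm f a z k := by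
    rw [Finset.sum_range_succ']
    have : 0 ≤ ∑ k ∈ Finset.range n, taylorTerm f a z (k + 1) := Finset.sum_nonneg fun k _ =>
      hf.taylorTerm_nonneg (hz.trans hza) hza.le k.succ_ne_zero
    have h0 : taylorTerm f a z 0 = f a := by simp [taylorTerm]
    linarith
  rw [hf.1.sub_sum_taylorTerm hy hya]
  refine h1.trans ?_
  rw [intervalIntegral.integral_const_mul]
  refine mul_le_mul_of_nonneg_left (h2.trans ?_)
    (pow_nonneg (div_nonneg (by linarith) (by linarith)) _)
  rw [← hf.1.sub_sum_taylorTerm hz hza]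
  linarith

/-- Bernstein's theorem: the Taylor series at `a` converges to the function on `(0, a)`. -/
theorem AlternatingDerivs.hasSum_taylorTerm (hf : AlternatingDerivs f) {a y : ℝ} (hy : 0 < y)
    (hya : y < a) : HasSum (taylorTerm f a y) (f y) := by
  have hlim : Tendsto (fun n => ∑ k ∈ Finset.range (n + 1), taylorTerm f a y k) atTop
      (𝓝 (f y)) := by
    have h0 : Tendsto (fun n : ℕ => ((a - y) / (a - y / 2)) ^ n * (f (y / 2) - f a)) atTop
        (𝓝 0) := by
      have := (tendsto_pow_atTop_nhds_zero_of_lt_one (r := (a - y) / (a - y / 2))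
        (div_nonneg (by linarith) (by linarith))
        ((div_lt_one (by linarith)).2 (by linarith))).mul_const (f (y / 2) - f a)
      simpa using this
    have := tendsto_of_tendsto_of_tendsto_of_le_of_le tendsto_const_nhds h0
      (fun n => hf.remainder_nonneg hy hya n)
      (fun n => hf.remainder_le (z := y / 2) (by linarith) (by linarith) hya n)
    simpa using this.const_sub (f y)
  -- The term of order 0 is `f a`, whose sign is unknown; all the others are nonnegative, so
  -- convergence of their partial sums suffices.
  have hs : Tendsto (fun n => ∑ k ∈ Finset.range n, taylorTerm f a y (k + 1)) atTop
      (𝓝 (f y - taylorTerm f a y 0)) := by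
    simpa only [Finset.sum_range_succ', add_sub_cancel_right] using
      hlim.sub_const (taylorTerm f a y 0)
  refine (hasSum_nat_add_iff' 1).1 ?_
  simpa using (hasSum_iff_tendsto_nat_of_nonneg (fun k =>
    hf.taylorTerm_nonneg (hy.trans hya) hya.le k.succ_ne_zero) _).2 hs

/-- At a centre `a` beyond `t` and `x`, each Taylor term at `s` dominates the one at `t`, strictly
if its order and coefficient are nonzero. Equal sums thus force all coefficients of positive order
to vanish. -/
theorem AlternatingDerivs.eq_of_eq (hf : AlternatingDerivs f) {s t : ℝ} (hs : 0 < s) (hst : s < t)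
    (h : f s = f t) {x : ℝ} (hx : 0 < x) : f x = f t := by
  set a := max t x + 1
  have hta : t < a := (le_max_left t x).trans_lt (lt_add_one _)
  have hxa : x < a := (le_max_right t x).trans_lt (lt_add_one _)
  have ha : 0 < a := hx.trans hxa
  have hterm : ∀ k, taylorTerm f a x k = taylorTerm f a t k := by
    intro k
    rcases eq_or_ne k 0 with rfl | hk
    · simp [taylorTerm]
    have hle : ∀ k, taylorTerm f a t k ≤ taylorTerm f a s k := by
      intro k
      rcases k with - | k
      · simp [taylorTerm]
      · exact mul_le_mul_of_nonneg_left
          (pow_le_pow_left₀ (by linarith) (by linarith) _)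
          (div_nonneg (hf.2 k a ha) (by positivity))
    have heq : taylorTerm f a t k = taylorTerm f a s k := by
      refine (hle k).eq_of_not_lt fun hlt => ?_
      exact (hasSum_lt hle hlt (hf.hasSum_taylorTerm (hs.trans hst) hta)
        (hf.hasSum_taylorTerm hs (hst.trans hta))).ne h.symm
    have hc : (-1 : ℝ) ^ k * iteratedDeriv k f a / k.factorial = 0 := by
      by_contra hne
      exact (pow_lt_pow_left₀ (by linarith : a - t < a - s) (by linarith) hk).ne
        (mul_left_cancel₀ hne heq)
    simp [taylorTerm, hc]
  have h1 := hf.hasSum_taylorTerm hx hxa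
  rw [funext hterm] at h1
  exact h1.unique (hf.hasSum_taylorTerm (hs.trans hst) hta)

end Taylor

/-! ### Functions of conditionally negative definite kernels. -/

section Composition

variable {X : Type*} {γ : X → X → ℝ} {f : ℝ → ℝ}

theorem tendsto_one_sub_exp_div (x : ℝ) :
    Tendsto (fun s : ℝ => (1 - Real.exp (-(s * x))) / s) (𝓝[>] 0) (𝓝 x) := by
  have h : HasDerivAt (fun s : ℝ => 1 - Real.exp (-(s * x))) x 0 := by
    simpa using ((((hasDerivAt_id (0 : ℝ)).mul_const x).neg).exp).const_sub 1
  have := (hasDerivAt_iff_tendsto_slope_zero.1 h).mono_left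
    (nhdsWithin_mono 0 (show Ioi (0 : ℝ) ⊆ {0}ᶜ from fun s hs => ne_of_gt hs))
  simpa [div_eq_inv_mul] using this

/-- The centre `1 / s` makes the increment exactly `u / s`, so the expansion is a power series in
`u`. -/
theorem taylorTerm_one_div (f : ℝ → ℝ) (s u : ℝ) (k : ℕ) :
    taylorTerm f (1 / s) ((1 - u) / s) k =
      (-1 : ℝ) ^ k * iteratedDeriv k f (1 / s) / k.factorial * (s⁻¹) ^ k * u ^ k := by
  rw [taylorTerm, mul_assoc _ ((s⁻¹) ^ k), ← mul_pow]
  congr 2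
  ring

theorem AlternatingDerivs.hasSum_exp (hf : AlternatingDerivs f) {s x : ℝ} (hs : 0 < s)
    (hx : 0 < x) :
    HasSum (fun k : ℕ => (-1 : ℝ) ^ k * iteratedDeriv k f (1 / s) / k.factorial * (s⁻¹) ^ k *
      Real.exp (-(s * x)) ^ k) (f ((1 - Real.exp (-(s * x))) / s)) := by
  simp only [← taylorTerm_one_div]
  refine hf.hasSum_taylorTerm (div_pos ?_ hs) (div_lt_div_of_pos_right ?_ hs)
  · rw [sub_pos, Real.exp_lt_one_iff]
    exact neg_neg_of_pos (mul_pos hs hx)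
  · exact sub_lt_self _ (Real.exp_pos _)

theorem AlternatingDerivs.tendsto_comp (hf : AlternatingDerivs f) {x : ℝ} (hx : 0 < x) :
    Tendsto (fun s : ℝ => f ((1 - Real.exp (-(s * x))) / s)) (𝓝[>] 0) (𝓝 (f x)) :=
  ((hf.1.continuousOn.continuousAt (Ioi_mem_nhds hx)).tendsto).comp (tendsto_one_sub_exp_div x)

/-- Only the constant term of the series may have the wrong sign, and zero-sum weights annihilate
it. -/
theorem AlternatingDerivs.isCondNeg_neg_comp (hf : AlternatingDerivs f) (hγ : IsCondNeg γ)
    (hs : ∀ x y, γ x y = γ y x) (hpos : ∀ x y, 0 < γ x y) :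
    IsCondNeg fun x y => -f (γ x y) := by
  refine IsCondNeg.of_tendsto (l := 𝓝[>] (0 : ℝ)) (A := fun s x y =>
    -f ((1 - Real.exp (-(s * γ x y))) / s)) ?_ fun x y => (hf.tendsto_comp (hpos x y)).neg
  filter_upwards [self_mem_nhdsWithin] with s (hs0 : 0 < s)
  have hE := (hγ.smul hs0.le).isCovariance_exp_neg fun x y => by rw [hs]
  have hK := IsCovariance.of_hasSum (fun k : ℕ => (hE.pow (k + 1)).smul (mul_nonneg
      (div_nonneg (hf.2 k (1 / s) (by positivity)) (by positivity : (0 : ℝ) ≤ (k + 1).factorial))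
      (by positivity : 0 ≤ (s⁻¹) ^ (k + 1))))
    fun x y => (hasSum_nat_add_iff' 1).2 (hf.hasSum_exp hs0 (hpos x y))
  refine (congrArg IsCondNeg (funext₂ fun x y => ?_)).mpr
    (hK.isCondNeg_neg.add (IsCondNeg.of_const (-f (1 / s))))
  simp only [Finset.range_one, Finset.sum_singleton, pow_zero, iteratedDeriv_zero,
    Nat.factorial_zero, Nat.cast_one]
  ring

theorem IsCompletelyMonotone.isCovariance_comp (hf : IsCompletelyMonotone f) (hγ : IsCondNeg γ)
    (hs : ∀ x y, γ x y = γ y x) (hpos : ∀ x y, 0 < γ x y) :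
    IsCovariance fun x y => f (γ x y) := by
  refine IsCovariance.of_tendsto (l := 𝓝[>] (0 : ℝ)) (A := fun s x y =>
    f ((1 - Real.exp (-(s * γ x y))) / s)) ?_ fun x y =>
      hf.alternatingDerivs.tendsto_comp (hpos x y)
  filter_upwards [self_mem_nhdsWithin] with s (hs0 : 0 < s)
  have hE := (hγ.smul hs0.le).isCovariance_exp_neg fun x y => by rw [hs]
  exact IsCovariance.of_hasSum (fun k : ℕ => (hE.pow k).smul (mul_nonneg
      (div_nonneg (hf.2 k (1 / s) (by positivity)) (by positivity : (0 : ℝ) ≤ k.factorial))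
      (by positivity : 0 ≤ (s⁻¹) ^ k)))
    fun x y => hf.alternatingDerivs.hasSum_exp hs0 (hpos x y)

theorem alternatingDerivs_neg_sqrt : AlternatingDerivs fun t => -√t := by
  have hcd : ContDiffOn ℝ ∞ (fun t : ℝ => √t) (Ioi 0) := fun t ht =>
    (Real.contDiffAt_sqrt (ne_of_gt ht)).contDiffWithinAt
  refine ⟨hcd.neg, fun k t ht => ?_⟩
  -- Each further factor `1/2 - (k + 1)` of the falling factorial is negative.
  have hsign : ∀ k : ℕ, (-1 : ℝ) ^ (k + 1) * (descPochhammer ℝ (k + 1)).eval (1 / 2 : ℝ) ≤ 0 := by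
    intro k
    induction k with
    | zero => norm_num
    | succ k ih =>
      rw [descPochhammer_succ_right, pow_succ, Polynomial.eval_mul]
      simp only [Polynomial.eval_sub, Polynomial.eval_X, Polynomial.eval_natCast]
      have : 0 ≤ -(1 / 2 - ((k + 1 : ℕ) : ℝ)) := by push_cast; linarith [k.cast_nonneg (α := ℝ)]
      have := mul_nonpos_of_nonpos_of_nonneg ih this
      linarith
  have h := Real.iter_deriv_rpow_const (1 / 2) t (k + 1)
  rw [← iteratedDeriv_eq_iterate] at h
  rw [show (fun t => -√t) = -(fun t : ℝ => t ^ (1 / 2 : ℝ)) by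
    ext t; simp [Real.sqrt_eq_rpow], iteratedDeriv_neg, h, mul_neg, ← mul_assoc, ← neg_mul]
  exact mul_nonneg (neg_nonneg.2 (hsign k)) (Real.rpow_nonneg ht.le _)

/-- The square root is a Bernstein function, applied here to the squared distance; adding `s` keeps
its argument positive on the diagonal. -/
theorem isCondNeg_norm_sub {V : Type*} [NormedAddCommGroup V] [InnerProductSpace ℝ V] :
    IsCondNeg fun x y : V => ‖x - y‖ := by
  refine IsCondNeg.of_tendsto (l := 𝓝[>] (0 : ℝ)) (A := fun s x y => √(‖x - y‖ ^ 2 + s)) ?_ ?_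
  · filter_upwards [self_mem_nhdsWithin] with s (hs : 0 < s)
    simpa using alternatingDerivs_neg_sqrt.isCondNeg_neg_comp
      (isCondNeg_norm_sub_sq.add (IsCondNeg.of_const s)) (fun x y => by rw [norm_sub_rev])
      fun x y : V => by positivity
  · intro x y
    have : Continuous fun s : ℝ => √(‖x - y‖ ^ 2 + s) := by fun_prop
    simpa using (this.tendsto 0).mono_left nhdsWithin_le_nhds

end Composition

theorem isVariogram_iff_isCondNeg {G : Type*} [AddCommGroup G] {γ : G → ℝ} :
    IsVariogram γ ↔ IsCondNeg fun x y => γ (x - y) :=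
  Iff.rfl

/-! ### Generators and quasi-arithmetic compositions. -/

namespace IsCMGenerator

variable {φ φinv : ℝ → ℝ} {D E : Set ℝ}

theorem isUpperSet (hφ : IsCMGenerator φ φinv D E) : IsUpperSet D := by
  rcases hφ.domain_eq with rfl | rfl
  exacts [isUpperSet_Ioi 0, isUpperSet_Ici 0]

theorem Ioi_subset (hφ : IsCMGenerator φ φinv D E) : Ioi 0 ⊆ D := by
  rcases hφ.domain_eq with rfl | rfl
  exacts [subset_rfl, Ioi_subset_Ici_self]

theorem subset_Ici (hφ : IsCMGenerator φ φinv D E) : D ⊆ Ici 0 := by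
  rcases hφ.domain_eq with rfl | rfl
  exacts [Ioi_subset_Ici_self, subset_rfl]

theorem antitoneOn (hφ : IsCMGenerator φ φinv D E) : AntitoneOn φ D := by
  have hD : Convex ℝ D := by
    rcases hφ.domain_eq with rfl | rfl
    exacts [convex_Ioi 0, convex_Ici 0]
  have hi : interior D = Ioi 0 := by
    rcases hφ.domain_eq with rfl | rfl
    exacts [isOpen_Ioi.interior_eq, interior_Ici]
  refine antitoneOn_of_deriv_nonpos hD hφ.continuousOn ?_ ?_
  · rw [hi]
    exact hφ.completelyMonotone.1.differentiableOn (by simp)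
  · rw [hi]
    intro t ht
    have := hφ.completelyMonotone.2 1 t ht
    rw [iteratedDeriv_one] at this
    linarith

/-- A completely monotone generator is constant or strictly decreasing. -/
theorem const_or_strictAntiOn (hφ : IsCMGenerator φ φinv D E) :
    (∀ t ∈ D, φ t = φ 1) ∨ StrictAntiOn φ D := by
  refine or_iff_not_imp_right.2 fun h => ?_
  simp only [StrictAntiOn, not_forall, not_lt] at h
  obtain ⟨s, hs, t, ht, hst, hle⟩ := h
  have hs0 : 0 ≤ s := hφ.subset_Ici hs
  -- `s` may be 0, where the Taylor argument does not apply; the midpoint is positive and `φ` takes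
  -- the same value there.
  have hmD : (s + t) / 2 ∈ D := hφ.isUpperSet (by linarith : s ≤ (s + t) / 2) hs
  have hmt : φ ((s + t) / 2) = φ t := le_antisymm
    ((hφ.antitoneOn hs hmD (by linarith)).trans hle) (hφ.antitoneOn hmD ht (by linarith))
  have hconst : EqOn φ (fun _ => φ 1) (Ioi 0) := fun x hx => by
    have key : ∀ {x : ℝ}, 0 < x → φ x = φ t :=
      hφ.completelyMonotone.alternatingDerivs.eq_of_eq
        (by linarith : 0 < (s + t) / 2) (by linarith) hmt
    exact (key hx).trans (key one_pos).symm
  exact hconst.of_subset_closure hφ.continuousOn continuousOn_const hφ.Ioi_subset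
    (by rw [closure_Ioi]; exact hφ.subset_Ici)

theorem nonneg_one (hφ : IsCMGenerator φ φinv D E) : 0 ≤ φ 1 := by
  simpa using hφ.completelyMonotone.2 0 1 one_pos

/-- For `b ∈ D`, strict monotonicity turns `b < φinv (C x)` into the open condition `C x < φ b`, and
likewise for `>`. A `b` outside the upper set `D` lies below all values of `φinv ∘ C`. -/
theorem continuous_inv_comp (hφ : IsCMGenerator φ φinv D E) (hanti : StrictAntiOn φ D)
    {X : Type*} [TopologicalSpace X] {C : X → ℝ} (hC : Continuous C) (hE : ∀ x, C x ∈ E) :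
    Continuous fun x => φinv (C x) := by
  have hmem : ∀ x, φinv (C x) ∈ D := fun x => hφ.mapsTo (hE x)
  have hval : ∀ x, φ (φinv (C x)) = C x := fun x => hφ.apply_inv _ (hE x)
  refine continuous_iff_continuousAt.2 fun x₀ => tendsto_order.2 ⟨fun b hb => ?_, fun b hb => ?_⟩
  · by_cases hbD : b ∈ D
    · have : C x₀ < φ b := hval x₀ ▸ hanti hbD (hmem x₀) hb
      filter_upwards [hC.continuousAt.eventually_lt_const this] with x hx
      exact (hanti.lt_iff_gt (hmem x) hbD).1 (by rwa [hval])
    · exact Eventually.of_forall fun x => lt_of_not_ge fun h => hbD (hφ.isUpperSet h (hmem x))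
  · have hbD : b ∈ D := hφ.isUpperSet hb.le (hmem x₀)
    have : φ b < C x₀ := hval x₀ ▸ hanti (hmem x₀) hbD hb
    filter_upwards [hC.continuousAt.eventually_const_lt this] with x hx
    exact (hanti.lt_iff_gt hbD (hmem x)).1 (by rwa [hval])

theorem isCovariance_comp (hφ : IsCMGenerator φ φinv D E) {X : Type*} {γ : X → X → ℝ}
    (hγ : IsCondNeg γ) (hs : ∀ x y, γ x y = γ y x) (hD : ∀ x y, γ x y ∈ D) :
    IsCovariance fun x y => φ (γ x y) := by
  have hpos : ∀ {s : ℝ}, 0 < s → ∀ x y, 0 < γ x y + s := fun hs x y =>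
    add_pos_of_nonneg_of_pos (hφ.subset_Ici (hD x y)) hs
  refine IsCovariance.of_tendsto (l := 𝓝[>] (0 : ℝ)) (A := fun s x y => φ (γ x y + s)) ?_ ?_
  · filter_upwards [self_mem_nhdsWithin] with s (hs0 : 0 < s)
    exact hφ.completelyMonotone.isCovariance_comp (hγ.add (IsCondNeg.of_const s))
      (fun x y => by rw [hs]) (hpos hs0)
  · intro x y
    refine (hφ.continuousOn _ (hD x y)).tendsto.comp (tendsto_nhdsWithin_iff.2 ⟨?_, ?_⟩)
    · have : Continuous fun s : ℝ => γ x y + s := by fun_prop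
      simpa using (this.tendsto 0).mono_left nhdsWithin_le_nhds
    · filter_upwards [self_mem_nhdsWithin] with s (hs0 : 0 < s)
      exact hφ.Ioi_subset (hpos hs0 x y)

section QuasiArith

variable {n : ℕ} {θ : Fin n → ℝ} {V : Fin n → Type*} {C : ∀ i, V i → ℝ}

theorem sum_mem (hφ : IsCMGenerator φ φinv D E) (hθ : ∀ i, 0 ≤ θ i)
    (hθD : (∃ i, 0 < θ i) ∨ (0 : ℝ) ∈ D) (hE : ∀ i x, C i x ∈ E) (x : ∀ i, V i) :
    ∑ i, θ i * φinv (C i (x i)) ∈ D := by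
  have hmem : ∀ i, φinv (C i (x i)) ∈ D := fun i => hφ.mapsTo (hE i _)
  have hnn : ∀ i, 0 ≤ θ i * φinv (C i (x i)) := fun i =>
    mul_nonneg (hθ i) (hφ.subset_Ici (hmem i))
  by_cases h0 : (0 : ℝ) ∈ D
  · exact hφ.isUpperSet (Finset.sum_nonneg fun i _ => hnn i) h0
  · obtain ⟨i, hi⟩ := hθD.resolve_right h0
    have hpos : 0 < φinv (C i (x i)) :=
      lt_of_not_ge fun h => h0 (hφ.isUpperSet h (hmem i))
    exact hφ.Ioi_subset (Finset.sum_pos' (fun i _ => hnn i)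
      ⟨i, Finset.mem_univ i, mul_pos hi hpos⟩)

/-- The quasi-arithmetic composition of continuous stationary covariance functions whose
transforms `φinv ∘ C i` are variograms; the latter is only needed if `φ` is not constant. -/
theorem continuous_and_isStationaryCovariance [∀ i, AddCommGroup (V i)]
    [∀ i, TopologicalSpace (V i)]     (hφ : IsCMGenerator φ φinv D E) (hθ : ∀ i, 0 ≤ θ i)
    (hθD : (∃ i, 0 < θ i) ∨ (0 : ℝ) ∈ D) (hC : ∀ i, Continuous (C i))
    (hcov : ∀ i, IsStationaryCovariance (C i)) (hE : ∀ i x, C i x ∈ E)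
    (hvar : ∀ i, StrictAntiOn φ D → IsVariogram fun x => φinv (C i x)) :
    Continuous (quasiArith φ φinv θ C) ∧ IsStationaryCovariance (quasiArith φ φinv θ C) := by
  have hmem := hφ.sum_mem hθ hθD hE
  -- For constant `φ`, the inverse may be discontinuous, but the composition is a nonnegative
  -- constant.
  rcases hφ.const_or_strictAntiOn with hc | hanti
  · have : quasiArith φ φinv θ C = fun _ => φ 1 := funext fun x => hc _ (hmem x)
    rw [this]
    exact ⟨continuous_const, IsCovariance.const hφ.nonneg_one⟩
  · refine ⟨hφ.continuousOn.comp_continuous (continuous_finsetSum _ fun i _ =>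
      ((hφ.continuous_inv_comp hanti (hC i) (hE i)).comp (continuous_apply i)).const_mul _) hmem,
      hφ.isCovariance_comp (γ := fun x y : ∀ i, V i => ∑ i, θ i * φinv (C i ((x - y) i))) ?_ ?_
        fun x y => hmem (x - y)⟩
    · exact IsCondNeg.finsetSum _ fun i =>
        ((isVariogram_iff_isCondNeg.1 (hvar i hanti)).comp fun x : ∀ i, V i => x i).smul (hθ i)
    · intro x y
      refine Finset.sum_congr rfl fun i _ => ?_
      exact congrArg (fun u => θ i * φinv u) ((hcov i).1 (x i) (y i))

end QuasiArith

end IsCMGenerator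

/-! ### Full symmetry and variograms with a radial profile. -/

theorem isFullySymmetric_quasiArith (φ φinv : ℝ → ℝ) {n : ℕ} (θ : Fin n → ℝ) {V : Fin n → Type*}
    [∀ i, AddCommGroup (V i)] {C : ∀ i, V i → ℝ} (hC : ∀ i x, C i (-x) = C i x) :
    IsFullySymmetric (quasiArith φ φinv θ C) := by
  intro S x
  refine congrArg φ (Finset.sum_congr rfl fun i _ => ?_)
  dsimp only
  split_ifs with h
  · rw [hC]
  · rfl

/-- Conditions on `g` over `(0, ∞)` do not cover the diagonal, where the norm is 0; the shift by `s`
avoids it and continuity removes the shift. -/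
theorem isVariogram_comp_norm_of_tendsto {V : Type*} [NormedAddCommGroup V] {g : ℝ → ℝ}
    (hg : Continuous fun t : ℝ => g |t|)
    (h : ∀ s > 0, IsVariogram fun x : V => g (‖x‖ + s)) : IsVariogram fun x : V => g ‖x‖ := by
  refine isVariogram_iff_isCondNeg.2 <| IsCondNeg.of_tendsto (l := 𝓝[>] (0 : ℝ))
    (A := fun s (x y : V) => g (‖x - y‖ + s)) ?_ ?_
  · filter_upwards [self_mem_nhdsWithin] with s hs using h s hs
  · intro x y
    have hc : Continuous fun s : ℝ => g |‖x - y‖ + s| :=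
      hg.comp (continuous_const.add continuous_id)
    have := (hc.tendsto 0).mono_left (nhdsWithin_le_nhds (s := Ioi 0))
    simp only [add_zero, abs_norm] at this
    refine this.congr' ?_
    filter_upwards [self_mem_nhdsWithin] with s (hs : 0 < s)
    rw [abs_of_nonneg (by positivity)]

theorem IsBernstein.isVariogram_comp_norm {V : Type*} [NormedAddCommGroup V]
    [InnerProductSpace ℝ V] {g : ℝ → ℝ} (hg : IsBernstein g)
    (hc : Continuous fun t : ℝ => g |t|) : IsVariogram fun x : V => g ‖x‖ := by
  refine isVariogram_comp_norm_of_tendsto hc fun s hs => ?_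
  have := hg.alternatingDerivs_neg.isCondNeg_neg_comp
    (isCondNeg_norm_sub.add (IsCondNeg.of_const s)) (fun x y => by rw [norm_sub_rev])
    fun x y : V => by positivity
  simp only [neg_neg] at this
  exact this

/-- On a finite set, a nondecreasing concave function coincides with a nonnegative combination of
the functions `r ↦ min r a` and a constant. -/
theorem exists_isVariogram_interpolation (T : Finset ℝ) : (∀ t ∈ T, 0 ≤ t) → ∀ g : ℝ → ℝ,
    (∀ x ∈ T, ∀ y ∈ T, x ≤ y → g x ≤ g y) →
    (∀ x ∈ T, ∀ y ∈ T, ∀ z ∈ T, x < y → y < z → (g z - g y) / (z - y) ≤ (g y - g x) / (y - x)) →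
    ∃ h : ℝ → ℝ, (IsVariogram fun x : ℝ => h |x|) ∧ (∀ t ∈ T, h t = g t) ∧
      ∀ M ∈ T, (∀ t ∈ T, t ≤ M) → ∀ r ≥ M, h r = h M := by
  induction T using Finset.induction_on_max with
  | empty => exact fun _ g _ _ => ⟨fun _ => 0, IsCondNeg.of_const 0, by simp, by simp⟩
  | insert a T haT ih =>
    intro hT g hmono hslope
    have ha : 0 ≤ a := hT a (Finset.mem_insert_self a T)
    rcases T.eq_empty_or_nonempty with rfl | hne
    · exact ⟨fun _ => g a, IsCondNeg.of_const _, by simp, by simp⟩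
    obtain ⟨M, hM, hMmax⟩ : ∃ M ∈ T, ∀ t ∈ T, t ≤ M :=
      ⟨T.max' hne, T.max'_mem hne, fun t ht => T.le_max' t ht⟩
    have hMa := haT M hM
    -- The last chord has the least slope, so `g r - s * r` is still nondecreasing with decreasing
    -- slopes on `T`. Adding `s * min r a` to its interpolant restores `g` on `T`, and also at `a`
    -- because the interpolant is constant beyond `M`.
    set s := (g a - g M) / (a - M) with hs
    have hsub : ∀ t ∈ T, t ∈ insert a T := fun t ht => Finset.mem_insert_of_mem ht
    have haI : a ∈ insert a T := Finset.mem_insert_self a T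
    have hs0 : 0 ≤ s := div_nonneg (sub_nonneg.2 (hmono M (hsub M hM) a haI hMa.le)) (by linarith)
    have hsM : ∀ y ∈ T, s ≤ (g a - g y) / (a - y) := by
      intro y hy
      rcases (hMmax y hy).eq_or_lt with rfl | hyM
      · exact le_rfl
      have h1 := hslope y (hsub y hy) M (hsub M hM) a haI hyM hMa
      rw [← hs, le_div_iff₀ (by linarith)] at h1
      have h2 : s * (a - M) = g a - g M := div_mul_cancel₀ _ (by linarith)
      rw [le_div_iff₀ (by linarith [haT y hy])]
      linarith
    obtain ⟨h, hvar, heq, hconst⟩ := ih (fun t ht => hT t (hsub t ht)) (fun r => g r - s * r) (by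
        intro x hx y hy hxy
        rcases hxy.eq_or_lt with rfl | hlt
        · exact le_rfl
        have h1 := (hsM y hy).trans (hslope x (hsub x hx) y (hsub y hy) a haI hlt (haT y hy))
        rw [le_div_iff₀ (by linarith)] at h1
        linarith) (by
        intro x hx y hy z hz hxy hyz
        have h1 := hslope x (hsub x hx) y (hsub y hy) z (hsub z hz) hxy hyz
        have e : ∀ u v : ℝ, u < v →
            (g v - s * v - (g u - s * u)) / (v - u) = (g v - g u) / (v - u) - s := by
          intro u v huv
          have : v - u ≠ 0 := by linarith
          field_simp
          ring
        simp only [e _ _ hxy, e _ _ hyz]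
        linarith)
    refine ⟨fun r => h r + s * min r a,
      (isVariogram_iff_isCondNeg.1 hvar).add ((isCondNeg_min_abs_sub ha).smul hs0), ?_, ?_⟩
    · intro t ht
      rcases Finset.mem_insert.1 ht with rfl | ht
      · have h2 : s * (t - M) = g t - g M := div_mul_cancel₀ _ (by linarith)
        simp only [hconst M hM hMmax t hMa.le, heq M hM, min_self]
        linarith
      · simp only [heq t ht, min_eq_left (haT t ht).le]
        ring
    · intro N hN hNmax r hr
      obtain rfl : N = a := le_antisymm
        ((Finset.mem_insert.1 hN).elim le_of_eq fun h => (haT N h).le) (hNmax a haI)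
      simp only [hconst M hM hMmax r (by linarith), hconst M hM hMmax N hMa.le, min_self,
        min_eq_right hr]

/-- A nondecreasing concave function of the distance on the real line is a variogram. -/
theorem isVariogram_comp_abs_of_concaveOn {g : ℝ → ℝ} (hmono : MonotoneOn g (Ici 0))
    (hconc : ConcaveOn ℝ (Ici 0) g) : IsVariogram fun x : ℝ => g |x| := by
  intro m a x ha
  classical
  -- The quadratic form sees `g` only at these distances.
  let T : Finset ℝ := Finset.univ.image fun p : Fin m × Fin m => |x p.1 - x p.2|
  have hT : ∀ t ∈ T, 0 ≤ t := by
    intro t ht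
    obtain ⟨p, -, rfl⟩ := Finset.mem_image.1 ht
    exact abs_nonneg _
  obtain ⟨h, hvar, heq, -⟩ := exists_isVariogram_interpolation T hT g
    (fun u hu v hv => hmono (hT u hu) (hT v hv))
    fun u hu v _ w hw huv hvw => hconc.slope_anti_adjacent (hT u hu) (hT w hw) huv hvw
  refine le_of_eq_of_le ?_ (hvar m a x ha)
  refine Finset.sum_congr rfl fun i _ => Finset.sum_congr rfl fun j _ => ?_
  simp only [heq _ (Finset.mem_image_of_mem (fun p : Fin m × Fin m => |x p.1 - x p.2|)
    (Finset.mem_univ (i, j)))]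

theorem isVariogram_comp_abs_of_concaveOn_Ioi {g : ℝ → ℝ} (hc : Continuous fun t : ℝ => g |t|)
    (hmono : MonotoneOn g (Ioi 0)) (hconc : ConcaveOn ℝ (Ioi 0) g) :
    IsVariogram fun x : ℝ => g |x| := by
  refine isVariogram_comp_norm_of_tendsto (V := ℝ) hc fun s hs => ?_
  have hpos : ∀ r ∈ Ici (0 : ℝ), r + s ∈ Ioi (0 : ℝ) := fun r (hr : 0 ≤ r) => by
    simp only [mem_Ioi]; linarith
  refine isVariogram_comp_abs_of_concaveOn (g := fun r => g (r + s))
    (fun u hu v hv huv => hmono (hpos u hu) (hpos v hv) (by linarith))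
    ⟨convex_Ici 0, fun u hu v hv p q hp hq hpq => ?_⟩
  have := hconc.2 (hpos u hu) (hpos v hv) hp hq hpq
  simp only [smul_eq_mul] at this ⊢
  convert this using 2
  linear_combination (-s) * hpq

theorem proposition2 (φ φinv : ℝ → ℝ) (D E : Set ℝ) (hφ : IsCMGenerator φ φinv D E)
    (n : ℕ) (θ : Fin n → ℝ) (hθ : ∀ i, 0 ≤ θ i) (hθD : (∃ i, 0 < θ i) ∨ (0 : ℝ) ∈ D) :
    -- (a) general case
    (∀ (d : Fin n → ℕ), (∀ i, 0 < d i) →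
      ∀ C : ∀ i, EuclideanSpace ℝ (Fin (d i)) → ℝ,
        (∀ i, Continuous (C i)) →
        (∀ i, IsStationaryCovariance (C i)) →
        (∀ i x, C i x ∈ E) →
        (∀ i, IsVariogram fun x => φinv (C i x)) →
        Continuous (quasiArith φ φinv θ C) ∧
          IsStationaryCovariance (quasiArith φ φinv θ C)) ∧
    -- (b) component-wise isotropy; `c i` is the radial profile of the `i`-th covariance
    (∀ (d : Fin n → ℕ), (∀ i, 0 < d i) →
      ∀ c : Fin n → ℝ → ℝ,
        (∀ i, Continuous fun x : EuclideanSpace ℝ (Fin (d i)) => c i ‖x‖) →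
        (∀ i, IsStationaryCovariance fun x : EuclideanSpace ℝ (Fin (d i)) => c i ‖x‖) →
        (∀ i (x : EuclideanSpace ℝ (Fin (d i))), c i ‖x‖ ∈ E) →
        (∀ i, IsBernstein fun r => φinv (c i r)) →
        Continuous (quasiArith φ φinv θ
            fun i (x : EuclideanSpace ℝ (Fin (d i))) => c i ‖x‖) ∧
          IsStationaryCovariance (quasiArith φ φinv θ
            fun i (x : EuclideanSpace ℝ (Fin (d i))) => c i ‖x‖) ∧
          IsFullySymmetric (quasiArith φ φinv θ
            fun i (x : EuclideanSpace ℝ (Fin (d i))) => c i ‖x‖)) ∧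
    -- (c) univariate covariances
    (∀ c : Fin n → ℝ → ℝ,
      (∀ i, Continuous fun x : ℝ => c i |x|) →
      (∀ i, IsStationaryCovariance fun x : ℝ => c i |x|) →
      (∀ i (x : ℝ), c i |x| ∈ E) →
      (∀ i, ContinuousOn (fun r => φinv (c i r)) (Ioi 0)) →
      (∀ i, MonotoneOn (fun r => φinv (c i r)) (Ioi 0)) →
      (∀ i, ConcaveOn ℝ (Ioi 0) fun r => φinv (c i r)) →
      Continuous (quasiArith φ φinv θ fun i (x : ℝ) => c i |x|) ∧
        IsStationaryCovariance (quasiArith φ φinv θ fun i (x : ℝ) => c i |x|) ∧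
        IsFullySymmetric (quasiArith φ φinv θ fun i (x : ℝ) => c i |x|)) := by
  refine ⟨fun d _ C hC hcov hE hvar => ?_, fun d hd c hC hcov hE hB => ?_,
    fun c hC hcov hE _ hmono hconc => ?_⟩
  · exact hφ.continuous_and_isStationaryCovariance hθ hθD hC hcov hE fun i _ => hvar i
  · refine and_assoc.1 ⟨hφ.continuous_and_isStationaryCovariance hθ hθD hC hcov hE
      fun i hanti => (hB i).isVariogram_comp_norm ?_,
      isFullySymmetric_quasiArith φ φinv θ fun i x => by rw [norm_neg]⟩
    -- The profile is continuous because it can be read off along a coordinate axis, which exists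
    -- since `0 < d i`.
    have hray := (hφ.continuous_inv_comp (C := fun x : EuclideanSpace ℝ (Fin (d i)) => c i ‖x‖)
      hanti (hC i) (hE i)).comp
      ((continuous_id (X := ℝ)).smul
        (continuous_const (y := EuclideanSpace.single (⟨0, hd i⟩ : Fin (d i)) (1 : ℝ))))
    simpa [Function.comp_def, norm_smul] using hray
  · refine and_assoc.1 ⟨hφ.continuous_and_isStationaryCovariance hθ hθD hC hcov hE
      fun i hanti => isVariogram_comp_abs_of_concaveOn_Ioi
        (hφ.continuous_inv_comp (C := fun x => c i |x|) hanti (hC i) (hE i)) (hmono i) (hconc i),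
      isFullySymmetric_quasiArith φ φinv θ fun i x => by rw [abs_neg]⟩
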